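/- Let $(S_n^{(1)}, S_n^{(2)})_{n\ge 0}$ be a bivariate random walk, that is, a sequence of random vectors in $\mathbb{R}^2$ with $(S_0^{(1)},S_0^{(2)})=(0,0)$ almost surely and with independent identically distributed increments, and suppose that $(S_1^{(1)}, S_1^{(2)})$ and $(S_1^{(1)}, -S_1^{(2)})$ have the same distribution. Then for every $n \ge 1$ and every Borel set $B \subset \mathbb{R}$, $$\mathbb{P}\Bigl\{ S_n^{(1)} \in B,\ \min_{1 \le i \le n} S_i^{(2)} \ge 0 \Bigr\} \ge \mathbb{P}\bigl\{ S_n^{(1)} \in B \bigr\}\, \mathbb{P}\Bigl\{ \min_{1 \le i \le n} S_i^{(2)} > 0 \Bigr\}$$ and $$\mathbb{P}\Bigl\{ S_n^{(1)} \in B,\ \min_{1 \le i \le n} S_i^{(2)} > 0 \Bigr\} \le \mathbb{P}\bigl\{ S_n^{(1)} \in B \bigr\}\, \mathbb{P}\Bigl\{ \min_{1 \le i \le n} S_i^{(2)} \ge 0 \Bigr\}.$$ Moreover, if the distribution of $S_1^{(2)}$ is continuous, that is, has no atoms, then for every $n \ge 1$ and every Borel set $B \subset \mathbb{R}$ the events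 $\{S_n^{(1)} \in B\}$ and $\{\min_{1 \le i \le n} S_i^{(2)} > 0\}$ are independent. -/

import Mathlib

open MeasureTheory ProbabilityTheory

/-- `S` is a random walk in the plane under `P`: it starts at the origin almost surely and its
increments are independent and identically distributed. -/
structure IsBivariateRandomWalk {Ω : Type*} [MeasurableSpace Ω] (S : ℕ → Ω → ℝ × ℝ)
    (P : Measure Ω) : Prop where
  measurable : ∀ n, Measurable (S n)
  start : ∀ᵐ ω ∂P, S 0 ω = 0
  indep : iIndepFun (fun (n : ℕ) (ω : Ω) => S (n + 1) ω - S n ω) P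
  identDistrib : ∀ n : ℕ,
    IdentDistrib (fun ω => S (n + 1) ω - S n ω) (fun ω => S 1 ω - S 0 ω) P P

/-- `min_{1 ≤ i ≤ n} S_i^{(2)}`, for `n ≥ 1`. -/
noncomputable def minSnd {Ω : Type*} (S : ℕ → Ω → ℝ × ℝ) (n : ℕ) (hn : 1 ≤ n) (ω : Ω) : ℝ :=
  (Finset.Icc 1 n).inf' (Finset.nonempty_Icc.mpr hn) (fun i => (S i ω).2)

/-!
Suppose first that the heights `S_i^{(2)}` are almost surely distinct, and split the walk at the
time `k ≤ n` at which its height is maximal. Run backwards from time `k`, the first part is a walk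
that stays positive; by symmetry, the reflected second part is an independent walk that stays
positive. If `μ_n` is the law of `S_n^{(1)}` and `ρ_n` its restriction to
`min_{1 ≤ i ≤ n} S_i^{(2)} > 0`, this says `μ_n = ∑ₖ ρ_k ∗ ρ_{n-k}`. Since `μ_k ∗ μ_m = μ_{k+m}`,
induction on `n` forces `ρ_n` to be a multiple of `μ_n`, which is the independence.

In general, ties between heights are broken by comparing them lexicographically with an independent
Gaussian walk. Positivity of the lexicographic height lies between `min > 0` and `min ≥ 0`, and this
turns the independence into the two inequalities.
-/

open scoped ENNReal

section Convolution

open Finset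

lemma eq_smul_of_add_self_add_smul_eq {F : Type*} [MeasurableSpace F] {μ ρ : Measure F}
    [IsProbabilityMeasure μ] {c : ℝ≥0∞} (h : ρ + ρ + c • μ = μ) : ρ = ρ Set.univ • μ := by
  have huniv : ρ Set.univ + ρ Set.univ + c = 1 := by simpa using congr($h Set.univ)
  have hc : c ≠ ∞ := by rintro rfl; simp at huniv
  ext s -
  have hs : ρ s + ρ s + c * μ s = μ s := by simpa using congr($h s)
  have hdouble : 2 * ρ s = 2 * (ρ Set.univ * μ s) := by
    refine (ENNReal.add_left_inj (ENNReal.mul_ne_top hc (measure_ne_top μ s))).1 ?_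
    rw [two_mul, two_mul, hs, ← add_mul, ← add_mul, huniv, one_mul]
  exact (ENNReal.mul_right_inj two_ne_zero ENNReal.ofNat_ne_top).1 hdouble

variable {F : Type*} [AddMonoid F] [MeasurableSpace F] [MeasurableAdd₂ F] {μ ρ : ℕ → Measure F}

lemma sum_range_succ_succ_conv [∀ n, SFinite (ρ n)] (h0 : ρ 0 = Measure.dirac 0) (n : ℕ) :
    ∑ k ∈ range (n + 2), ρ k ∗ ρ (n + 1 - k)
      = ρ (n + 1) + ρ (n + 1) + ∑ k ∈ range n, ρ (k + 1) ∗ ρ (n - k) := by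
  rw [sum_range_succ, sum_range_succ']
  simp only [Nat.add_sub_add_right, Nat.sub_zero, Nat.sub_self, h0, Measure.dirac_zero_conv,
    Measure.conv_dirac_zero]
  abel

theorem eq_smul_of_sum_conv_eq [∀ n, IsProbabilityMeasure (μ n)] [∀ n, SFinite (ρ n)]
    (h0 : ρ 0 = Measure.dirac 0) (hμ : ∀ m n, μ m ∗ μ n = μ (m + n))
    (h : ∀ n, ∑ k ∈ range (n + 1), ρ k ∗ ρ (n - k) = μ n) (n : ℕ) :
    ρ n = ρ n Set.univ • μ n := by
  induction n using Nat.strong_induction_on with | _ n ih => ?_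
  obtain _ | n := n
  · have : μ 0 = Measure.dirac 0 := by simpa [h0] using (h 0).symm
    simp [h0, this]
  have hmiddle : ∀ k ∈ range n, ρ (k + 1) ∗ ρ (n - k)
      = (ρ (k + 1) Set.univ * ρ (n - k) Set.univ) • μ (n + 1) := fun k hk => by
    have hk := mem_range.1 hk
    rw [ih (k + 1) (by lia), ih (n - k) (by lia), Measure.conv_smul_left,
      Measure.conv_smul_right, hμ, smul_smul, show k + 1 + (n - k) = n + 1 by lia]
    simp
  refine eq_smul_of_add_self_add_smul_eq
    (c := ∑ k ∈ range n, ρ (k + 1) Set.univ * ρ (n - k) Set.univ) ?_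
  rw [sum_smul, ← sum_congr rfl hmiddle, ← sum_range_succ_succ_conv h0, h]

end Convolution

section Paths

open Finset

/-- The law of a sequence of independent random variables with common law `ν`. -/
noncomputable abbrev iidLaw {E : Type*} [MeasurableSpace E] (ν : Measure E) : Measure (ℕ → E) :=
  Measure.infinitePi fun _ => ν

/-- The position after `n` steps of the walk with steps `v`. -/
def walk {E : Type*} [AddCommMonoid E] (v : ℕ → E) (n : ℕ) : E := ∑ i ∈ range n, v i

/-- The sequence that runs through the first `k` terms of `p.1` backwards, and then through the
images under `τ` of the terms of `p.2`. -/
def splice {E : Type*} (τ : E → E) (k : ℕ) (p : (ℕ → E) × (ℕ → E)) (i : ℕ) : E :=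
  if i < k then p.1 (k - 1 - i) else τ (p.2 (i - k))

@[fun_prop]
lemma measurable_walk {E : Type*} [AddCommMonoid E] [MeasurableSpace E] [MeasurableAdd₂ E]
    (n : ℕ) : Measurable fun v : ℕ → E => walk v n :=
  Finset.measurable_sum _ fun i _ => measurable_pi_apply i

@[simp]
lemma walk_zero {E : Type*} [AddCommMonoid E] (v : ℕ → E) : walk v 0 = 0 := rfl

lemma walk_sub_walk {E : Type*} [AddCommGroup E] (v : ℕ → E) {m n : ℕ} (h : m ≤ n) :
    walk v n - walk v m = ∑ i ∈ Ico m n, v i :=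
  (sum_Ico_eq_sub v h).symm

lemma walk_splice_of_le {E : Type*} [AddCommGroup E] (τ : E → E) {j k : ℕ} (hj : j ≤ k)
    (p : (ℕ → E) × (ℕ → E)) :
    walk (splice τ k p) j = walk p.1 k - walk p.1 (k - j) := by
  rw [walk_sub_walk _ (Nat.sub_le k j), sum_Ico_eq_sum_range, Nat.sub_sub_self hj,
    ← sum_range_reflect, walk]
  refine sum_congr rfl fun i hi => ?_
  have hi := mem_range.1 hi
  rw [splice, if_pos (by lia), show k - j + (j - 1 - i) = k - 1 - i by lia]

lemma walk_splice_add {E : Type*} [AddCommGroup E] (τ : E →+ E) (k m : ℕ)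
    (p : (ℕ → E) × (ℕ → E)) :
    walk (splice τ k p) (k + m) = walk p.1 k + τ (walk p.2 m) := by
  have hk : walk (splice τ k p) k = walk p.1 k := by
    rw [walk_splice_of_le τ le_rfl, Nat.sub_self, walk_zero, sub_zero]
  rw [walk, sum_range_add, ← walk, hk]
  simp [splice, walk]

lemma measurePreserving_infinitePi_pi_reindex {ι κ E : Type*} [MeasurableSpace E] {ν : Measure E}
    [IsProbabilityMeasure ν] {g : κ → E → E} (hg : ∀ i, MeasurePreserving (g i) ν ν) {r : κ → ι}
    (hr : r.Injective) :
    MeasurePreserving (fun (v : ι → E) i => g i (v (r i))) (Measure.infinitePi fun _ => ν)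
      (Measure.infinitePi fun _ => ν) := by
  have hr' : MeasurePreserving (fun (v : ι → E) i => v (r i)) (Measure.infinitePi fun _ => ν)
      (Measure.infinitePi fun _ => ν) :=
    ⟨by fun_prop, Measure.map_infinitePi_infinitePi_of_inj hr⟩
  have hg' : MeasurePreserving (fun (v : κ → E) i => g i (v i)) (Measure.infinitePi fun _ => ν)
      (Measure.infinitePi fun _ => ν) :=
    ⟨measurable_pi_lambda _ fun i => (hg i).measurable.comp (measurable_pi_apply i), by
      simp_rw [Measure.infinitePi_map_pi _ fun i => (hg i).measurable, (hg _).map_eq]⟩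
  exact hg'.comp hr'

lemma measurePreserving_curry_finTwo {E : Type*} [MeasurableSpace E] (ν : Measure E)
    [IsProbabilityMeasure ν] :
    MeasurePreserving (fun v : Fin 2 × ℕ → E => (fun j => v (0, j), fun j => v (1, j)))
      (Measure.infinitePi fun _ => ν) ((iidLaw ν).prod (iidLaw ν)) := by
  have hcurry : MeasurePreserving (MeasurableEquiv.curry (Fin 2) ℕ E)
      (Measure.infinitePi fun _ => ν) (Measure.pi fun _ => iidLaw ν) :=
    ⟨by fun_prop, by rw [Measure.infinitePi_map_curry fun _ _ => ν, Measure.infinitePi_eq_pi]⟩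
  exact (measurePreserving_finTwoArrow (iidLaw ν)).comp hcurry

lemma measurePreserving_splice {E : Type*} [MeasurableSpace E] {ν : Measure E}
    [IsProbabilityMeasure ν] {τ : E → E} (hτ : MeasurePreserving τ ν ν) (k : ℕ) :
    MeasurePreserving (splice τ k) ((iidLaw ν).prod (iidLaw ν)) (iidLaw ν) := by
  have hτm := hτ.measurable
  have hmeas : Measurable (splice τ k) := by
    refine measurable_pi_iff.2 fun i => ?_
    unfold splice
    split_ifs <;> fun_prop
  let r (i : ℕ) : Fin 2 × ℕ := if i < k then (0, k - 1 - i) else (1, i - k)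
  have hr : r.Injective := fun i j h => by
    simp only [r] at h
    split_ifs at h <;> simp only [Prod.mk.injEq, zero_ne_one, one_ne_zero, false_and] at h <;> lia
  have hg (i : ℕ) : MeasurePreserving (if i < k then id else τ) ν ν := by
    split_ifs
    exacts [.id ν, hτ]
  have hcurry := measurePreserving_curry_finTwo ν
  have hcomp : MeasurePreserving
      (splice τ k ∘ fun v : Fin 2 × ℕ → E => (fun j => v (0, j), fun j => v (1, j)))
      (Measure.infinitePi fun _ => ν) (iidLaw ν) := by
    convert measurePreserving_infinitePi_pi_reindex hg hr using 1
    ext v i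
    by_cases hi : i < k <;> simp [splice, r, hi]
  rw [← hcurry.map_eq]
  exact hcomp.map_of_comp hmeas hcurry.measurable

end Paths

section Heights

open Finset

variable {E L : Type*} [AddCommGroup E] [AddCommGroup L] [LinearOrder L]

/-- The step sequences whose walk has positive height `φ` at the times `1, …, n`. -/
def positivePaths (φ : E →+ L) (n : ℕ) : Set (ℕ → E) :=
  {v | ∀ j ∈ Icc 1 n, 0 < φ (walk v j)}

/-- The step sequences whose walk up to time `n` is strictly highest at time `k`. -/
def argmaxPaths (φ : E →+ L) (k n : ℕ) : Set (ℕ → E) :=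
  {v | ∀ j ∈ range (n + 1), j ≠ k → φ (walk v j) < φ (walk v k)}

lemma pairwiseDisjoint_argmaxPaths (φ : E →+ L) (n : ℕ) :
    (range (n + 1) : Set ℕ).PairwiseDisjoint fun k => argmaxPaths φ k n :=
  fun _ hk _ hl hkl => Set.disjoint_left.2 fun _ hvk hvl =>
    (hvk _ hl hkl.symm).not_gt (hvl _ hk hkl)

lemma exists_mem_argmaxPaths {φ : E →+ L} {v : ℕ → E}
    (hv : Function.Injective fun n => φ (walk v n)) (n : ℕ) :
    ∃ k ∈ range (n + 1), v ∈ argmaxPaths φ k n := by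
  obtain ⟨k, hk, hmax⟩ := exists_max_image (range (n + 1)) (fun j => φ (walk v j)) ⟨0, by simp⟩
  exact ⟨k, hk, fun j hj hjk => (hmax j hj).lt_of_ne (hv.ne hjk)⟩

variable [IsOrderedAddMonoid L]

lemma splice_mem_argmaxPaths_iff {φ : E →+ L} {τ : E →+ E} (hφτ : ∀ e, φ (τ e) = -φ e) (k m : ℕ)
    (p : (ℕ → E) × (ℕ → E)) :
    splice τ k p ∈ argmaxPaths φ k (k + m) ↔ p ∈ positivePaths φ k ×ˢ positivePaths φ m := by
  have hmax : φ (walk (splice τ k p) k) = φ (walk p.1 k) := by simp [walk_splice_of_le]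
  have hleft {j} (hj : j ≤ k) : φ (walk (splice τ k p) j) < φ (walk (splice τ k p) k) ↔
      0 < φ (walk p.1 (k - j)) := by
    rw [hmax, walk_splice_of_le _ hj, map_sub, sub_lt_self_iff]
  have hright (j) : φ (walk (splice τ k p) (k + j)) < φ (walk (splice τ k p) k) ↔
      0 < φ (walk p.2 j) := by
    rw [hmax, walk_splice_add, map_add, hφτ, ← sub_eq_add_neg, sub_lt_self_iff]
  simp only [argmaxPaths, positivePaths, Set.mem_prod, Set.mem_ofPred_eq, mem_Icc, mem_range]
  constructor
  · refine fun h => ⟨fun j hj => ?_, fun j hj => ?_⟩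
    · simpa [Nat.sub_sub_self hj.2] using (hleft (Nat.sub_le k j)).1 (h _ (by lia) (by lia))
    · exact (hright j).1 (h _ (by lia) (by lia))
  · rintro ⟨hfst, hsnd⟩ j hj hjk
    obtain hlt | hlt := hjk.lt_or_gt
    · exact (hleft hlt.le).2 (hfst _ (by lia))
    · obtain ⟨i, rfl⟩ := Nat.exists_eq_add_of_lt hlt
      exact (hright (i + 1)).2 (hsnd _ (by lia))

variable [MeasurableSpace E] [MeasurableAdd₂ E] {φ : E →+ L}

omit [IsOrderedAddMonoid L] in
lemma measurableSet_positivePaths (hφ : MeasurableSet {e | 0 < φ e}) (n : ℕ) :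
    MeasurableSet (positivePaths φ n) := by
  simp only [positivePaths, Set.ofPred_forall]
  exact (Icc 1 n).measurableSet_biInter fun j _ => measurable_walk j hφ

lemma measurableSet_argmaxPaths [MeasurableNeg E] (hφ : MeasurableSet {e | 0 < φ e}) (k n : ℕ) :
    MeasurableSet (argmaxPaths φ k n) := by
  simp only [argmaxPaths, Set.ofPred_forall, ← sub_pos (b := φ (walk _ _)), ← map_sub]
  have hsub (j : ℕ) : Measurable fun v : ℕ → E => walk v k - walk v j := by fun_prop
  exact (range (n + 1)).measurableSet_biInter fun j _ => .iInter fun _ => hsub j hφ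

end Heights

section Decomposition

open Finset

variable {E F L : Type*} [AddCommGroup E] [MeasurableSpace E] [AddCommGroup F] [MeasurableSpace F]
  [AddCommGroup L] [LinearOrder L]

/-- `τ` is a symmetry of the step law `ν` that keeps the observable `f` and reverses the sign of the
height `φ`. -/
structure IsReflection (ν : Measure E) (f : E →+ F) (φ : E →+ L) (τ : E →+ E) : Prop where
  measurePreserving : MeasurePreserving τ ν ν
  map_observable : ∀ e, f (τ e) = f e
  map_height : ∀ e, φ (τ e) = -φ e

/-- The law of the observable `f` at the endpoint of the first `n` steps, restricted to the step
sequences in `A`. -/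
noncomputable def endpointLaw (ν : Measure E) (f : E →+ F) (A : Set (ℕ → E)) (n : ℕ) : Measure F :=
  ((iidLaw ν).restrict A).map fun v => f (walk v n)

variable {ν : Measure E} {f : E →+ F} {φ : E →+ L} {τ : E →+ E} [MeasurableAdd₂ E]

lemma sum_endpointLaw_argmaxPaths [IsOrderedAddMonoid L] [MeasurableNeg E] (hf : Measurable f)
    (hφ : MeasurableSet {e | 0 < φ e})
    (hinj : ∀ᵐ v ∂iidLaw ν, Function.Injective fun n => φ (walk v n)) (n : ℕ) :
    ∑ k ∈ range (n + 1), endpointLaw ν f (argmaxPaths φ k n) n = endpointLaw ν f Set.univ n := by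
  have hfw : Measurable fun v : ℕ → E => f (walk v n) := hf.comp (measurable_walk n)
  have hunion : ∑ k ∈ range (n + 1), (iidLaw ν).restrict (argmaxPaths φ k n) = iidLaw ν := by
    rw [← sum_coe_sort, ← Measure.sum_fintype, ← Measure.restrict_biUnion_finset
      (pairwiseDisjoint_argmaxPaths φ n) fun k => measurableSet_argmaxPaths hφ k n]
    refine Measure.restrict_eq_self_of_ae_mem <| hinj.mono fun v hv => ?_
    simpa only [Set.mem_iUnion₂, exists_prop] using exists_mem_argmaxPaths hv n
  simp only [endpointLaw, Measure.restrict_univ]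
  rw [← Measure.map_finset_sum hfw.aemeasurable, hunion]

variable [IsProbabilityMeasure ν]

instance (A : Set (ℕ → E)) (n : ℕ) : IsFiniteMeasure (endpointLaw ν f A n) := by
  unfold endpointLaw
  infer_instance

lemma isProbabilityMeasure_endpointLaw_univ (hf : Measurable f) (n : ℕ) :
    IsProbabilityMeasure (endpointLaw ν f Set.univ n) := by
  rw [endpointLaw, Measure.restrict_univ]
  exact Measure.isProbabilityMeasure_map (hf.comp (measurable_walk n)).aemeasurable

variable [MeasurableAdd₂ F]

lemma endpointLaw_conv_endpointLaw (hf : Measurable f) (hτ : MeasurePreserving τ ν ν)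
    (hfτ : ∀ e, f (τ e) = f e) {k m : ℕ} {A A' C : Set (ℕ → E)} (hC : MeasurableSet C)
    (h : splice τ k ⁻¹' C = A ×ˢ A') :
    endpointLaw ν f A k ∗ endpointLaw ν f A' m = endpointLaw ν f C (k + m) := by
  have hsplice := (measurePreserving_splice hτ k).restrict_preimage hC
  have hfw (n) : Measurable fun v : ℕ → E => f (walk v n) := hf.comp (measurable_walk n)
  rw [endpointLaw, endpointLaw, endpointLaw, ← hsplice.map_eq, h, ← Measure.prod_restrict,
    Measure.conv, Measure.map_prod_map _ _ (hfw k) (hfw m),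
    Measure.map_map (by fun_prop) (by fun_prop), Measure.map_map (hfw _) hsplice.measurable]
  congr 1
  ext p
  simp [walk_splice_add, hfτ]

theorem indepSet_observable_positivePaths [IsOrderedAddMonoid L] [MeasurableNeg E]
    (hf : Measurable f) (hφ : MeasurableSet {e | 0 < φ e}) (hτ : IsReflection ν f φ τ)
    (hinj : ∀ᵐ v ∂iidLaw ν, Function.Injective fun n => φ (walk v n)) (n : ℕ) {B : Set F}
    (hB : MeasurableSet B) :
    IndepSet {v | f (walk v n) ∈ B} (positivePaths φ n) (iidLaw ν) := by
  have hfw (n) : Measurable fun v : ℕ → E => f (walk v n) := hf.comp (measurable_walk n)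
  have hconv (m n) : endpointLaw ν f Set.univ m ∗ endpointLaw ν f Set.univ n
      = endpointLaw ν f Set.univ (m + n) :=
    endpointLaw_conv_endpointLaw hf hτ.measurePreserving hτ.map_observable .univ (by simp)
  have hsum (n) : ∑ k ∈ range (n + 1), endpointLaw ν f (positivePaths φ k) k ∗
      endpointLaw ν f (positivePaths φ (n - k)) (n - k) = endpointLaw ν f Set.univ n := by
    rw [← sum_endpointLaw_argmaxPaths hf hφ hinj n]
    refine sum_congr rfl fun k hk => ?_
    obtain ⟨m, rfl⟩ := Nat.exists_eq_add_of_le (mem_range_succ_iff.1 hk)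
    rw [Nat.add_sub_cancel_left]
    exact endpointLaw_conv_endpointLaw hf hτ.measurePreserving hτ.map_observable
      (measurableSet_argmaxPaths hφ _ _) (Set.ext (splice_mem_argmaxPaths_iff hτ.map_height k m))
  have hprob := isProbabilityMeasure_endpointLaw_univ (ν := ν) hf
  have hzero : endpointLaw ν f (positivePaths φ 0) 0 = Measure.dirac 0 := by
    simp [endpointLaw, positivePaths]
  have hsmul := eq_smul_of_sum_conv_eq (ρ := fun n => endpointLaw ν f (positivePaths φ n) n)
    hzero hconv hsum n
  change IndepSet ((fun v => f (walk v n)) ⁻¹' B) _ _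
  rw [indepSet_iff_measure_inter_eq_mul (hfw n hB) (measurableSet_positivePaths hφ n) (iidLaw ν)]
  simpa [endpointLaw, hfw n, hB, Measure.restrict_apply (hfw n hB), mul_comm] using congr($hsmul B)

end Decomposition

section Injectivity

open Finset

instance nullSingletonClass_conv {M : Type*} [AddGroup M] [MeasurableSpace M] [MeasurableAdd₂ M]
    [MeasurableSingletonClass M] (μ ν : Measure M) [SFinite ν] [NullSingletonClass ν] :
    NullSingletonClass (μ ∗ ν) where
  measure_singleton a := by
    rw [Measure.conv, Measure.map_apply (by fun_prop) (measurableSet_singleton a),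
      Measure.measure_prod_null ((measurableSet_singleton a).preimage (by fun_prop))]
    refine .of_forall fun x => ?_
    have hsection : Prod.mk x ⁻¹' ((fun p : M × M => p.1 + p.2) ⁻¹' {a}) = {-x + a} := by
      ext y
      simp [eq_neg_add_iff_add_eq]
    simp [hsection]

lemma ae_finsetSum_ne_of_iIndepFun {Ω ι M : Type*} [MeasurableSpace Ω] {P : Measure Ω}
    [AddCommGroup M] [MeasurableSpace M] [MeasurableAdd₂ M] [MeasurableSingletonClass M]
    {Y : ι → Ω → M} (hY : iIndepFun Y P) (hYm : ∀ i, Measurable (Y i)) {s : Finset ι} {j : ι}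
    (hj : j ∈ s) [NullSingletonClass (P.map (Y j))] (a : M) :
    ∀ᵐ ω ∂P, ∑ i ∈ s, Y i ω ≠ a := by
  classical
  have := hY.isProbabilityMeasure
  have hrest : Measurable (∑ i ∈ s.erase j, Y i) := by fun_prop
  have hlaw : P.map (∑ i ∈ s, Y i) = P.map (∑ i ∈ s.erase j, Y i) ∗ P.map (Y j) := by
    rw [← sum_erase_add s Y hj, (hY.indepFun_finsetSum_of_notMem hYm
      (notMem_erase j s)).map_add_eq_map_conv_map hrest (hYm j)]
  have hne : ∀ᵐ x ∂P.map (∑ i ∈ s, Y i), x ≠ a := hlaw ▸ Measure.ae_ne _ a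
  simpa using ae_of_ae_map (by fun_prop) hne

lemma ae_injective_walk {E M : Type*} [AddCommGroup E] [MeasurableSpace E]
    [AddCommGroup M] [MeasurableSpace M] [MeasurableAdd₂ M] [MeasurableSingletonClass M]
    {ν : Measure E} [IsProbabilityMeasure ν] {ψ : E →+ M} (hψ : Measurable ψ)
    [NullSingletonClass (ν.map ψ)] :
    ∀ᵐ v ∂iidLaw ν, Function.Injective fun n => ψ (walk v n) := by
  have hindep : iIndepFun (fun i (v : ℕ → E) => ψ (v i)) (iidLaw ν) :=
    iIndepFun_infinitePi fun _ => hψ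
  have hlaw (i : ℕ) : (iidLaw ν).map (fun v => ψ (v i)) = ν.map ψ := by
    change (iidLaw ν).map (ψ ∘ fun v => v i) = ν.map ψ
    rw [← Measure.map_map hψ (by fun_prop), Measure.infinitePi_map_eval]
  have hne {m n : ℕ} (hmn : m < n) : ∀ᵐ v ∂iidLaw ν, ψ (walk v m) ≠ ψ (walk v n) := by
    have : NullSingletonClass ((iidLaw ν).map fun v => ψ (v m)) := hlaw m ▸ inferInstance
    filter_upwards [ae_finsetSum_ne_of_iIndepFun hindep (fun i => by fun_prop)
      (left_mem_Ico.2 hmn) 0] with v hv heq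
    rw [← map_sum, ← walk_sub_walk v hmn.le, map_sub, heq, sub_self] at hv
    exact hv rfl
  have hne' : ∀ᵐ v ∂iidLaw ν, ∀ m n, m < n → ψ (walk v m) ≠ ψ (walk v n) := by
    simpa only [ae_all_iff] using fun m n => hne
  exact hne'.mono fun v hv => .of_lt_imp_ne hv

end Injectivity

section RandomWalk

/-- `S` is a random walk under `P`: it starts at the origin almost surely and its increments are
independent and identically distributed. This is `IsBivariateRandomWalk` for walks in a group. -/
structure IsRandomWalk {Ω E : Type*} [MeasurableSpace Ω] [AddCommGroup E] [MeasurableSpace E]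
    (S : ℕ → Ω → E) (P : Measure Ω) : Prop where
  measurable : ∀ n, Measurable (S n)
  start : ∀ᵐ ω ∂P, S 0 ω = 0
  indep : iIndepFun (fun (n : ℕ) (ω : Ω) => S (n + 1) ω - S n ω) P
  identDistrib : ∀ n : ℕ,
    IdentDistrib (fun ω => S (n + 1) ω - S n ω) (fun ω => S 1 ω - S 0 ω) P P

variable {Ω E : Type*} [MeasurableSpace Ω] {P : Measure Ω} [AddCommGroup E] [MeasurableSpace E]
  {S : ℕ → Ω → E}

lemma IsRandomWalk.ae_eq_walk (hS : IsRandomWalk S P) :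
    ∀ᵐ ω ∂P, ∀ n, walk (fun i => S (i + 1) ω - S i ω) n = S n ω := by
  filter_upwards [hS.start] with ω hω n
  simp [walk, Finset.sum_range_sub (fun i => S i ω), hω]

lemma IsRandomWalk.map_increments (hS : IsRandomWalk S P) [MeasurableAdd₂ E] [MeasurableNeg E] :
    P.map (fun ω i => S (i + 1) ω - S i ω) = iidLaw (P.map (S 1)) := by
  have hm (i) : Measurable fun ω => S (i + 1) ω - S i ω :=
    (hS.measurable (i + 1)).sub (hS.measurable i)
  have hfirst : (fun ω => S 1 ω - S 0 ω) =ᵐ[P] S 1 := by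
    filter_upwards [hS.start] with ω hω
    rw [hω, sub_zero]
  have hlaw (i) : P.map (fun ω => S (i + 1) ω - S i ω) = P.map (S 1) :=
    (hS.identDistrib i).map_eq.trans (Measure.map_congr hfirst)
  simp_rw [hS.indep.map_fun_eq_infinitePi_map hm, hlaw]

/-- The steps of the model on the right may carry additional randomness, which `π` forgets. -/
lemma IsRandomWalk.identDistrib_walk (hS : IsRandomWalk S P) [MeasurableAdd₂ E] [MeasurableNeg E]
    {E' : Type*} [AddCommGroup E'] [MeasurableSpace E'] {ν : Measure E'}
    [IsProbabilityMeasure ν] {π : E' →+ E} (hπ : Measurable π) (hν : ν.map π = P.map (S 1)) :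
    IdentDistrib (fun ω n => S n ω) (fun v n => π (walk v n)) P (iidLaw ν) := by
  have hm (i) : Measurable fun ω => S (i + 1) ω - S i ω :=
    (hS.measurable (i + 1)).sub (hS.measurable i)
  have hsteps : IdentDistrib (fun ω i => S (i + 1) ω - S i ω) (fun v i => π (v i)) P (iidLaw ν) :=
    ⟨(measurable_pi_lambda _ hm).aemeasurable,
      (measurable_pi_lambda _ fun i => hπ.comp (measurable_pi_apply i)).aemeasurable, by
      rw [hS.map_increments, Measure.infinitePi_map_pi _ fun _ => hπ, hν]⟩
  have hwalk := hsteps.comp (measurable_pi_lambda (fun v : ℕ → E => walk v) measurable_walk)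
  have hpath : IdentDistrib (fun ω n => S n ω) (fun ω => walk fun i => S (i + 1) ω - S i ω) P P :=
    .of_ae_eq (measurable_pi_lambda _ hS.measurable).aemeasurable <|
      hS.ae_eq_walk.mono fun _ hω => funext fun n => (hω n).symm
  convert hpath.trans hwalk using 3 with v n
  simp [walk]

end RandomWalk

section Bivariate

variable {F G : Type*} [AddCommGroup F] [AddCommGroup G]

/-- The reflection of `F × G` that reverses the sign of the second coordinate. -/
def negSnd : F × G →+ F × G := (AddMonoidHom.id F).prodMap (-AddMonoidHom.id G)

/-- The height that compares second coordinates and breaks ties by an additional real number. -/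
noncomputable def lexHeight : (F × G) × ℝ →+ Lex (G × ℝ) :=
  (toLexAddEquiv (G × ℝ)).toAddMonoidHom.comp ((AddMonoidHom.snd F G).prodMap (.id ℝ))

section Order

variable [LinearOrder G]

lemma zero_lt_lexHeight_iff (e : (F × G) × ℝ) :
    0 < lexHeight e ↔ 0 < e.1.2 ∨ 0 = e.1.2 ∧ 0 < e.2 :=
  Prod.Lex.toLex_lt_toLex

lemma forall_zero_lt_subset_positivePaths_lexHeight (n : ℕ) :
    {v : ℕ → (F × G) × ℝ | ∀ i ∈ Finset.Icc 1 n, 0 < (walk v i).1.2}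
      ⊆ positivePaths lexHeight n :=
  fun _ hv i hi => (zero_lt_lexHeight_iff _).2 (.inl (hv i hi))

lemma positivePaths_lexHeight_subset_forall_zero_le (n : ℕ) :
    positivePaths lexHeight n
      ⊆ {v : ℕ → (F × G) × ℝ | ∀ i ∈ Finset.Icc 1 n, 0 ≤ (walk v i).1.2} :=
  fun _ hv i hi => ((zero_lt_lexHeight_iff _).1 (hv i hi)).elim le_of_lt fun h => h.1.le

end Order

variable [MeasurableSpace F] [MeasurableSpace G]

instance measurableAdd₂_prod [MeasurableAdd₂ F] [MeasurableAdd₂ G] : MeasurableAdd₂ (F × G) where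
  measurable_add := by
    simp only [Prod.add_def]
    fun_prop

instance measurableNeg_prod [MeasurableNeg F] [MeasurableNeg G] : MeasurableNeg (F × G) where
  measurable_neg := (measurable_fst.neg).prodMk (measurable_snd.neg)

/-- The standard Gaussian tie-break of `lexHeight`; any symmetric law without atoms would do. -/
noncomputable abbrev withTieBreak (ν : Measure (F × G)) : Measure ((F × G) × ℝ) :=
  ν.prod (gaussianReal 0 1)

lemma isReflection_fst_snd {ν : Measure (F × G)} (hν : MeasurePreserving negSnd ν ν) :
    IsReflection ν (.fst F G) (.snd F G) negSnd :=
  ⟨hν, fun _ => rfl, fun _ => rfl⟩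

lemma isReflection_lexHeight {ν : Measure (F × G)} [SFinite ν]
    (hν : MeasurePreserving negSnd ν ν) :
    IsReflection (withTieBreak ν) ((AddMonoidHom.fst F G).comp (.fst (F × G) ℝ)) lexHeight
      (negSnd.prodMap (-.id ℝ)) where
  measurePreserving := by
    have hneg : MeasurePreserving (fun x : ℝ => -x) (gaussianReal 0 1) (gaussianReal 0 1) :=
      ⟨measurable_neg, by simpa using gaussianReal_map_neg (μ := 0) (v := 1)⟩
    exact hν.prod hneg
  map_observable _ := rfl
  map_height _ := rfl

lemma measurableSet_zero_lt_lexHeight [LinearOrder G] [MeasurableSingletonClass G]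
    (hG : MeasurableSet {x : G | 0 < x}) :
    MeasurableSet {e : (F × G) × ℝ | 0 < lexHeight e} := by
  have hsnd : Measurable fun e : (F × G) × ℝ => e.1.2 := by fun_prop
  have htie : MeasurableSet {e : (F × G) × ℝ | 0 < e.2} := measurable_snd measurableSet_Ioi
  simp only [zero_lt_lexHeight_iff, eq_comm (a := (0 : G))]
  exact (hsnd hG).union ((hsnd (measurableSet_singleton 0)).inter htie)

lemma ae_injective_lexHeight_walk (ν : Measure (F × G)) [IsProbabilityMeasure ν] :
    ∀ᵐ v ∂iidLaw (withTieBreak ν), Function.Injective fun n => lexHeight (walk v n) := by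
  have hlaw : (withTieBreak ν).map (AddMonoidHom.snd (F × G) ℝ) = gaussianReal 0 1 :=
    measurePreserving_snd.map_eq
  have : NullSingletonClass ((withTieBreak ν).map (AddMonoidHom.snd (F × G) ℝ)) :=
    hlaw ▸ nullSingletonClass_gaussianReal one_ne_zero
  filter_upwards [ae_injective_walk (ψ := AddMonoidHom.snd (F × G) ℝ) measurable_snd] with v hv
  exact fun m n hmn => hv congr((ofLex $hmn).2)

theorem indepSet_fst_positivePaths_lexHeight [LinearOrder G] [IsOrderedAddMonoid G]
    [MeasurableSingletonClass G] [MeasurableAdd₂ F] [MeasurableAdd₂ G] [MeasurableNeg F]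
    [MeasurableNeg G] (hG : MeasurableSet {x : G | 0 < x}) {ν : Measure (F × G)}
    [IsProbabilityMeasure ν] (hν : MeasurePreserving negSnd ν ν) (n : ℕ) {B : Set F}
    (hB : MeasurableSet B) :
    IndepSet {v | (walk v n).1.1 ∈ B} (positivePaths lexHeight n) (iidLaw (withTieBreak ν)) :=
  indepSet_observable_positivePaths (measurable_fst.comp measurable_fst)
    (measurableSet_zero_lt_lexHeight hG) (isReflection_lexHeight hν)
    (ae_injective_lexHeight_walk ν) n hB

end Bivariate

section SymmetricWalk

variable {Ω F G : Type*} [MeasurableSpace Ω] {P : Measure Ω} [MeasurableSpace F]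
  [MeasurableSpace G]

/-- The paths whose first coordinate at time `n` lies in `B`. -/
def endsIn (G : Type*) (n : ℕ) (B : Set F) : Set (ℕ → F × G) := {s | (s n).1 ∈ B}

/-- The paths whose second coordinate lies in `C` at the times `1, …, n`. -/
def staysIn (F : Type*) (n : ℕ) (C : Set G) : Set (ℕ → F × G) :=
  {s | ∀ i ∈ Finset.Icc 1 n, (s i).2 ∈ C}

lemma measurableSet_endsIn (n : ℕ) {B : Set F} (hB : MeasurableSet B) :
    MeasurableSet (endsIn G n B) :=
  (measurable_fst.comp (measurable_pi_apply n)) hB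

lemma measurableSet_staysIn (n : ℕ) {C : Set G} (hC : MeasurableSet C) :
    MeasurableSet (staysIn F n C) := by
  simp only [staysIn, Set.ofPred_forall]
  exact (Finset.Icc 1 n).measurableSet_biInter fun i _ =>
    (measurable_snd.comp (measurable_pi_apply i)) hC

variable [AddCommGroup F] [AddCommGroup G] [MeasurableNeg G] {S : ℕ → Ω → F × G}

lemma IsRandomWalk.measurePreserving_negSnd (hS : IsRandomWalk S P)
    (hsymm : IdentDistrib (S 1) (fun ω => ((S 1 ω).1, -(S 1 ω).2)) P P) :
    MeasurePreserving negSnd (P.map (S 1)) (P.map (S 1)) := by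
  have hneg : Measurable (negSnd : F × G → F × G) := measurable_fst.prodMk measurable_snd.neg
  exact ⟨hneg, (Measure.map_map hneg (hS.measurable 1)).trans hsymm.map_eq.symm⟩

variable [MeasurableAdd₂ F] [MeasurableNeg F] [MeasurableAdd₂ G]

lemma IsRandomWalk.identDistrib_walk_withTieBreak (hS : IsRandomWalk S P)
    [IsProbabilityMeasure (P.map (S 1))] :
    IdentDistrib (fun ω n => S n ω) (fun v n => (walk v n).1) P
      (iidLaw (withTieBreak (P.map (S 1)))) :=
  hS.identDistrib_walk (π := AddMonoidHom.fst (F × G) ℝ) measurable_fst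
    measurePreserving_fst.map_eq

variable [LinearOrder G] [IsOrderedAddMonoid G] [TopologicalSpace G]
  [OrderClosedTopology G] [OpensMeasurableSpace G]

theorem IsRandomWalk.measure_mul_measure_pos_le (hS : IsRandomWalk S P)
    (hsymm : IdentDistrib (S 1) (fun ω => ((S 1 ω).1, -(S 1 ω).2)) P P)
    (n : ℕ) {B : Set F} (hB : MeasurableSet B) :
    P {ω | (S n ω).1 ∈ B} * P {ω | ∀ i ∈ Finset.Icc 1 n, 0 < (S i ω).2}
      ≤ P {ω | (S n ω).1 ∈ B ∧ ∀ i ∈ Finset.Icc 1 n, 0 ≤ (S i ω).2} := by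
  have := hS.indep.isProbabilityMeasure
  have := Measure.isProbabilityMeasure_map (μ := P) (hS.measurable 1).aemeasurable
  set Q := iidLaw (withTieBreak (P.map (S 1)))
  have hQ := hS.identDistrib_walk_withTieBreak
  have hindep := indepSet_fst_positivePaths_lexHeight measurableSet_Ioi
    (hS.measurePreserving_negSnd hsymm) n hB
  calc P {ω | (S n ω).1 ∈ B} * P {ω | ∀ i ∈ Finset.Icc 1 n, 0 < (S i ω).2}
      = Q {v | (walk v n).1.1 ∈ B} * Q {v | ∀ i ∈ Finset.Icc 1 n, 0 < (walk v i).1.2} :=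
        congr($(hQ.measure_mem_eq (measurableSet_endsIn n hB)) *
          $(hQ.measure_mem_eq (measurableSet_staysIn n measurableSet_Ioi)))
    _ ≤ Q {v | (walk v n).1.1 ∈ B} * Q (positivePaths lexHeight n) := by
        gcongr
        exact forall_zero_lt_subset_positivePaths_lexHeight n
    _ = Q ({v | (walk v n).1.1 ∈ B} ∩ positivePaths lexHeight n) :=
        hindep.measure_inter_eq_mul.symm
    _ ≤ Q ({v | (walk v n).1.1 ∈ B} ∩ {v | ∀ i ∈ Finset.Icc 1 n, 0 ≤ (walk v i).1.2}) := by
        gcongr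
        exact positivePaths_lexHeight_subset_forall_zero_le n
    _ = P {ω | (S n ω).1 ∈ B ∧ ∀ i ∈ Finset.Icc 1 n, 0 ≤ (S i ω).2} :=
        (hQ.measure_mem_eq
          ((measurableSet_endsIn n hB).inter (measurableSet_staysIn n measurableSet_Ici))).symm

theorem IsRandomWalk.measure_pos_le_measure_mul (hS : IsRandomWalk S P)
    (hsymm : IdentDistrib (S 1) (fun ω => ((S 1 ω).1, -(S 1 ω).2)) P P)
    (n : ℕ) {B : Set F} (hB : MeasurableSet B) :
    P {ω | (S n ω).1 ∈ B ∧ ∀ i ∈ Finset.Icc 1 n, 0 < (S i ω).2}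
      ≤ P {ω | (S n ω).1 ∈ B} * P {ω | ∀ i ∈ Finset.Icc 1 n, 0 ≤ (S i ω).2} := by
  have := hS.indep.isProbabilityMeasure
  have := Measure.isProbabilityMeasure_map (μ := P) (hS.measurable 1).aemeasurable
  set Q := iidLaw (withTieBreak (P.map (S 1)))
  have hQ := hS.identDistrib_walk_withTieBreak
  have hindep := indepSet_fst_positivePaths_lexHeight measurableSet_Ioi
    (hS.measurePreserving_negSnd hsymm) n hB
  calc P {ω | (S n ω).1 ∈ B ∧ ∀ i ∈ Finset.Icc 1 n, 0 < (S i ω).2}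
      = Q ({v | (walk v n).1.1 ∈ B} ∩ {v | ∀ i ∈ Finset.Icc 1 n, 0 < (walk v i).1.2}) :=
        hQ.measure_mem_eq
          ((measurableSet_endsIn n hB).inter (measurableSet_staysIn n measurableSet_Ioi))
    _ ≤ Q ({v | (walk v n).1.1 ∈ B} ∩ positivePaths lexHeight n) := by
        gcongr
        exact forall_zero_lt_subset_positivePaths_lexHeight n
    _ = Q {v | (walk v n).1.1 ∈ B} * Q (positivePaths lexHeight n) := hindep.measure_inter_eq_mul
    _ ≤ Q {v | (walk v n).1.1 ∈ B} * Q {v | ∀ i ∈ Finset.Icc 1 n, 0 ≤ (walk v i).1.2} := by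
        gcongr
        exact positivePaths_lexHeight_subset_forall_zero_le n
    _ = P {ω | (S n ω).1 ∈ B} * P {ω | ∀ i ∈ Finset.Icc 1 n, 0 ≤ (S i ω).2} :=
        congr($(hQ.measure_mem_eq (measurableSet_endsIn n hB)) *
          $(hQ.measure_mem_eq (measurableSet_staysIn n measurableSet_Ici))).symm

theorem IsRandomWalk.indepSet_pos (hS : IsRandomWalk S P)
    (hsymm : IdentDistrib (S 1) (fun ω => ((S 1 ω).1, -(S 1 ω).2)) P P)
    [NullSingletonClass (P.map fun ω => (S 1 ω).2)] (n : ℕ) {B : Set F} (hB : MeasurableSet B) :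
    IndepSet {ω | (S n ω).1 ∈ B} {ω | ∀ i ∈ Finset.Icc 1 n, 0 < (S i ω).2} P := by
  have := hS.indep.isProbabilityMeasure
  have := Measure.isProbabilityMeasure_map (μ := P) (hS.measurable 1).aemeasurable
  have hpath : Measurable fun ω n => S n ω := measurable_pi_lambda _ hS.measurable
  have hQ : IdentDistrib (fun ω n => S n ω) (fun v n => walk v n) P (iidLaw (P.map (S 1))) :=
    hS.identDistrib_walk (π := .id (F × G)) measurable_id Measure.map_id
  have hsnd : (P.map (S 1)).map (AddMonoidHom.snd F G) = P.map fun ω => (S 1 ω).2 :=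
    Measure.map_map measurable_snd (hS.measurable 1)
  have : NullSingletonClass ((P.map (S 1)).map (AddMonoidHom.snd F G)) := hsnd ▸ inferInstance
  have hpos : MeasurableSet {e : F × G | 0 < AddMonoidHom.snd F G e} :=
    measurable_snd measurableSet_Ioi
  have hindep := indepSet_observable_positivePaths measurable_fst hpos
    (isReflection_fst_snd (hS.measurePreserving_negSnd hsymm)) (ae_injective_walk measurable_snd)
    n hB
  have hends := measurableSet_endsIn (G := G) n hB
  have hstays := measurableSet_staysIn (F := F) n (measurableSet_Ioi (a := (0 : G)))
  refine (indepSet_iff_measure_inter_eq_mul (hpath hends) (hpath hstays) P).2 ?_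
  exact (hQ.measure_mem_eq (hends.inter hstays)).trans <| hindep.measure_inter_eq_mul.trans
    congr($(hQ.measure_mem_eq hends) * $(hQ.measure_mem_eq hstays)).symm

end SymmetricWalk

theorem proposition2_general {Ω F G : Type*} [MeasurableSpace Ω] [AddCommGroup F]
    [MeasurableSpace F] [MeasurableAdd₂ F] [MeasurableNeg F] [AddCommGroup G] [LinearOrder G]
    [IsOrderedAddMonoid G] [TopologicalSpace G] [OrderClosedTopology G] [MeasurableSpace G]
    [OpensMeasurableSpace G] [MeasurableAdd₂ G] [MeasurableNeg G] {P : Measure Ω}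
    {S : ℕ → Ω → F × G} (hS : IsRandomWalk S P)
    (hsymm : IdentDistrib (S 1) (fun ω => ((S 1 ω).1, -(S 1 ω).2)) P P) (n : ℕ) :
    (∀ B : Set F, MeasurableSet B →
      P {ω | (S n ω).1 ∈ B} * P {ω | ∀ i ∈ Finset.Icc 1 n, 0 < (S i ω).2}
        ≤ P {ω | (S n ω).1 ∈ B ∧ ∀ i ∈ Finset.Icc 1 n, 0 ≤ (S i ω).2}) ∧
    (∀ B : Set F, MeasurableSet B →
      P {ω | (S n ω).1 ∈ B ∧ ∀ i ∈ Finset.Icc 1 n, 0 < (S i ω).2}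
        ≤ P {ω | (S n ω).1 ∈ B} * P {ω | ∀ i ∈ Finset.Icc 1 n, 0 ≤ (S i ω).2}) ∧
    ((∀ a : G, P.map (fun ω => (S 1 ω).2) {a} = 0) →
      ∀ B : Set F, MeasurableSet B →
        IndepSet {ω | (S n ω).1 ∈ B} {ω | ∀ i ∈ Finset.Icc 1 n, 0 < (S i ω).2} P) :=
  ⟨fun _ => hS.measure_mul_measure_pos_le hsymm n,
    fun _ => hS.measure_pos_le_measure_mul hsymm n,
    fun hatom _ =>
      have : NullSingletonClass (P.map fun ω => (S 1 ω).2) := ⟨hatom⟩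
      hS.indepSet_pos hsymm n⟩

section Minimum

variable {Ω : Type*} {S : ℕ → Ω → ℝ × ℝ}

lemma IsBivariateRandomWalk.isRandomWalk [MeasurableSpace Ω] {P : Measure Ω}
    (hS : IsBivariateRandomWalk S P) : IsRandomWalk S P :=
  ⟨hS.measurable, hS.start, hS.indep, hS.identDistrib⟩

lemma lt_minSnd_iff {n : ℕ} (hn : 1 ≤ n) (a : ℝ) (ω : Ω) :
    a < minSnd S n hn ω ↔ ∀ i ∈ Finset.Icc 1 n, a < (S i ω).2 :=
  Finset.lt_inf'_iff _

lemma le_minSnd_iff {n : ℕ} (hn : 1 ≤ n) (a : ℝ) (ω : Ω) :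
    a ≤ minSnd S n hn ω ↔ ∀ i ∈ Finset.Icc 1 n, a ≤ (S i ω).2 :=
  Finset.le_inf'_iff _ _

end Minimum

theorem proposition2 {Ω : Type*} [MeasurableSpace Ω] (P : Measure Ω) [IsProbabilityMeasure P]
    (S : ℕ → Ω → ℝ × ℝ) (hS : IsBivariateRandomWalk S P)
    (hsymm : IdentDistrib (S 1) (fun ω => ((S 1 ω).1, -(S 1 ω).2)) P P)
    (n : ℕ) (hn : 1 ≤ n) :
    (∀ B : Set ℝ, MeasurableSet B →
      P {ω | (S n ω).1 ∈ B} * P {ω | 0 < minSnd S n hn ω}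
        ≤ P {ω | (S n ω).1 ∈ B ∧ 0 ≤ minSnd S n hn ω}) ∧
    (∀ B : Set ℝ, MeasurableSet B →
      P {ω | (S n ω).1 ∈ B ∧ 0 < minSnd S n hn ω}
        ≤ P {ω | (S n ω).1 ∈ B} * P {ω | 0 ≤ minSnd S n hn ω}) ∧
    ((∀ a : ℝ, P.map (fun ω => (S 1 ω).2) {a} = 0) →
      ∀ B : Set ℝ, MeasurableSet B →
        IndepSet {ω | (S n ω).1 ∈ B} {ω | 0 < minSnd S n hn ω} P) := by
  simpa only [lt_minSnd_iff, le_minSnd_iff] using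
    proposition2_general hS.isRandomWalk hsymm n
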